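/- Throughout, a Hilbert $\mathcal A$-module over a $C^*$-algebra $\mathcal A$ has an $\mathcal A$-valued inner product that is conjugate-linear in the first variable, and an operator $T:E\to F$ between Hilbert $\mathcal A$-modules is a linear map defined on a subspace $D(T)\subseteq E$. Its adjoint $T^*$ has domain $\{y\in F:\ \exists z\in E\ \forall x\in D(T)\ \langle Tx,y\rangle=\langle x,z\rangle\}$, and $T^*y=z$. The operator $T$ is *semiregular* if $D(T)$ is a dense $\mathcal A$-submodule of $E$, $T$ is closable and $T^*$ is densely defined. It is *regular* if it is closed, $D(T)$ is a dense $\mathcal A$-submodule of $E$, $T^*$ is densely defined and the range of $I+T^*T$ is dense in $E$, where $D(T^*T)=\{x\in D(T): Tx\in D(T^*)\}$. A subspace $S\subseteq D(T)$ is a *core* for $T$ if $T$ is the closure of $T|_S$. Let $\mathcal A=C[0,1]$ and $E=C[0,1]\otimes L_2(0,1)=C([0,1],L_2(0,1))$, with $\langle f,g\rangle(\pi)=\langle f_\pi,g_\pi\rangle$, and let $$D_0=\{f\in L_2(0,1): f\text{ absolutely continuous},\ f'\in L_2(0,1),\ f(0)=f(1)\},$$ $$D_{00}=\{f\in L_2(0,1):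 f\text{ absolutely continuous},\ f'\in L_2(0,1),\ f(0)=f(1)=0\}.$$ Define the operator $\boldsymbol t$ on $E$ by $$D(\boldsymbol t)=\{f\in E:\ f_0\in D_{00},\ f_\pi\in D_0\text{ for }0<\pi\le 1,\ \pi\mapsto f_\pi'\in L_2(0,1)\text{ continuous}\},\qquad (\boldsymbol tf)(\pi)=i f_\pi'.$$ **Proposition.** The operator $\boldsymbol t$ is closed and semiregular but not regular, and it satisfies the following: 1. $\boldsymbol t^*$ is regular; 2. $D(\boldsymbol t^*\boldsymbol t)$ is a core for $\boldsymbol t$. Consequently, regularity of the adjoint does not imply regularity of the operator: it is not true that for all separable $C^*$-algebras $\mathcal A$, all Hilbert $\mathcal A$-modules $E,F$ and all closed semiregular operators $T:E\to F$, regularity of $T^*$ implies regularity of $T$. -/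

import Mathlib

open MeasureTheory Set
open scoped ComplexOrder InnerProductSpace

noncomputable section

namespace HilbertModule

/-! ### Unbounded operators on Hilbert C⋆-modules

A Hilbert `A`-module is a complete normed space with a `CStarModule A` structure; an operator
`T : E → F` is a linear map defined on a complex subspace `D_T` of `E`. -/

section Operators

variable (A : Type*) {E F G : Type*} [NonUnitalCStarAlgebra A] [PartialOrder A]
  [NormedAddCommGroup E] [NormedSpace ℂ E] [SMul A E] [CStarModule A E]
  [NormedAddCommGroup F] [NormedSpace ℂ F] [SMul A F] [CStarModule A F]
  [NormedAddCommGroup G] [NormedSpace ℂ G]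

/-- The pairs `(y, z)` with `⟨T x, y⟩ = ⟨x, z⟩` for all `x` in the domain of `T`. -/
def adjointGraph (T : E →ₗ.[ℂ] F) : Submodule ℂ (F × E) where
  carrier := {p | ∀ x : T.domain, inner A (T x) p.1 = inner A (x : E) p.2}
  add_mem' {p q} hp hq x := by
    simp only [Prod.fst_add, Prod.snd_add, CStarModule.inner_add_right, hp x, hq x]
  zero_mem' x := by simp
  smul_mem' c p hp x := by
    simp only [Prod.smul_fst, Prod.smul_snd, CStarModule.inner_smul_right_complex, hp x]

/-- The adjoint `T*`. Its domain is `{y | ∃ z, ∀ x ∈ D_T, ⟨T x, y⟩ = ⟨x, z⟩}`, and `T* y = z`;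
here `z` is unique as soon as `D_T` is dense. -/
def adjoint (T : E →ₗ.[ℂ] F) : F →ₗ.[ℂ] E :=
  (adjointGraph A T).toLinearPMap

variable {A} in
/-- The composition `S T` with its natural domain `{x ∈ D_T | T x ∈ D_S}`. -/
def comp (S : F →ₗ.[ℂ] G) (T : E →ₗ.[ℂ] F) : E →ₗ.[ℂ] G where
  domain := (S.domain.comap T.toFun).map T.domain.subtype
  toFun :=
    { toFun := fun x => S ⟨T ⟨x, by
          obtain ⟨y, -, hy⟩ := x.2; rw [← hy]; exact y.2⟩, by
          obtain ⟨x, y, hy, rfl⟩ := x; exact hy⟩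
      map_add' := fun x y => by
        rw [← LinearPMap.map_add]; congr 1; ext1
        exact LinearPMap.map_add T ⟨x, _⟩ ⟨y, _⟩
      map_smul' := fun c x => by
        rw [RingHom.id_apply, ← LinearPMap.map_smul]; congr 1; ext1
        exact LinearPMap.map_smul T c ⟨x, _⟩ }

/-- Semiregular operators: the domain is a dense `A`-submodule, `T` is closable, and `T*` is
densely defined. -/
structure IsSemiregular (T : E →ₗ.[ℂ] F) : Prop where
  smul_mem : ∀ (a : A) (x : E), x ∈ T.domain → a • x ∈ T.domain
  dense_domain : Dense (T.domain : Set E)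
  isClosable : T.IsClosable
  dense_adjoint_domain : Dense ((adjoint A T).domain : Set F)

/-- Regular operators: `T` is closed, its domain is a dense `A`-submodule, `T*` is densely
defined, and the range of `I + T*T` is dense. -/
structure IsRegular (T : E →ₗ.[ℂ] F) : Prop where
  isClosed : T.IsClosed
  smul_mem : ∀ (a : A) (x : E), x ∈ T.domain → a • x ∈ T.domain
  dense_domain : Dense (T.domain : Set E)
  dense_adjoint_domain : Dense ((adjoint A T).domain : Set F)
  dense_range : Dense {y : E | ∃ x : (comp (adjoint A T) T).domain,
    (x : E) + comp (adjoint A T) T x = y}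

end Operators

/-! ### The Hilbert `C(X)`-module `C(X, H)` -/

/-- For a compact space `X` and a Hilbert space `H`, the space `C(X, H)` is a Hilbert module over
`C(X)` (the module `C(X) ⊗ H`), with `⟨f, g⟩(p) = ⟨f p, g p⟩`, conjugate-linear in `f`, and the
pointwise action of `C(X)`; its norm is the supremum norm. -/
instance instCStarModuleContinuousMap {X H : Type*} [TopologicalSpace X] [CompactSpace X]
    [NormedAddCommGroup H] [InnerProductSpace ℂ H] : CStarModule C(X, ℂ) C(X, H) where
  inner f g := ⟨fun p => ⟪f p, g p⟫_ℂ, f.continuous.inner g.continuous⟩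
  inner_add_right {f g h} := by ext p; simp
  inner_self_nonneg {f} p := by simp
  inner_self {f} := by
    constructor
    · intro h
      ext1 p
      exact inner_self_eq_zero.1 (DFunLike.congr_fun h p)
    · rintro rfl
      ext p
      simp
  inner_op_smul_right {a f g} := by ext p; simp
  inner_smul_right_complex {z f g} := by ext p; simp
  star_inner f g := by ext p; simp
  norm_eq_sqrt_norm_inner_self f := by
    apply le_antisymm
    · rw [ContinuousMap.norm_le _ (Real.sqrt_nonneg _)]
      intro p
      apply Real.le_sqrt_of_sq_le
      have := ContinuousMap.norm_coe_le_norm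
        (⟨fun p => ⟪f p, f p⟫_ℂ, f.continuous.inner f.continuous⟩ : C(X, ℂ)) p
      refine le_trans (le_of_eq ?_) this
      simp [inner_self_eq_norm_sq_to_K]
    · rw [Real.sqrt_le_left (norm_nonneg _), ContinuousMap.norm_le _ (by positivity)]
      intro p
      simp only [ContinuousMap.coe_mk, inner_self_eq_norm_sq_to_K, norm_pow]
      have := ContinuousMap.norm_coe_le_norm f p
      simp only [Complex.coe_algebraMap, Complex.norm_real, norm_norm]
      gcongr

/-! ### The operator `t` -/

/-- Lebesgue measure on `(0, 1)`. -/
abbrev μ01 : Measure ℝ := volume.restrict (Ioo 0 1)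

/-- `L₂(0, 1)`. -/
abbrev L2 : Type := Lp ℂ 2 μ01

/-- `u` is an absolutely continuous function on `[0, 1]` which represents `f ∈ L₂(0, 1)` and
whose derivative is in `L₂(0, 1)`. -/
structure IsACRep (f : L2) (u : ℝ → ℂ) : Prop where
  ac : AbsolutelyContinuousOnInterval u 0 1
  memLp_deriv : MemLp (deriv u) 2 μ01
  ae_eq : f =ᵐ[μ01] u

theorem IsACRep.ae_differentiableAt {f : L2} {u : ℝ → ℂ} (h : IsACRep f u) :
    ∀ᵐ x ∂μ01, DifferentiableAt ℝ u x := by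
  rw [ae_restrict_iff' measurableSet_Ioo]
  filter_upwards [h.ac.boundedVariationOn.ae_differentiableAt_of_mem_uIcc] with x hx hx'
  refine hx ?_
  rw [uIcc_of_le zero_le_one]
  exact Ioo_subset_Icc_self hx'

theorem IsACRep.add {f g : L2} {u v : ℝ → ℂ} (hf : IsACRep f u) (hg : IsACRep g v) :
    IsACRep (f + g) (u + v) ∧ deriv (u + v) =ᵐ[μ01] deriv u + deriv v := by
  have h : deriv (u + v) =ᵐ[μ01] deriv u + deriv v := by
    filter_upwards [hf.ae_differentiableAt, hg.ae_differentiableAt] with x hu hv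
    exact deriv_add hu hv
  refine ⟨⟨hf.ac.add hg.ac, (memLp_congr_ae h).2 (hf.memLp_deriv.add hg.memLp_deriv), ?_⟩, h⟩
  filter_upwards [Lp.coeFn_add f g, hf.ae_eq, hg.ae_eq] with x hx hu hv
  rw [hx, Pi.add_apply, Pi.add_apply, hu, hv]

theorem IsACRep.smul {f : L2} {u : ℝ → ℂ} (c : ℂ) (hf : IsACRep f u) :
    IsACRep (c • f) (c • u) ∧ deriv (c • u) =ᵐ[μ01] c • deriv u := by
  have h : deriv (c • u) =ᵐ[μ01] c • deriv u := by
    filter_upwards [hf.ae_differentiableAt] with x hu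
    exact deriv_const_smul c hu
  refine ⟨⟨hf.ac.const_smul c, (memLp_congr_ae h).2 (hf.memLp_deriv.const_smul c), ?_⟩, h⟩
  filter_upwards [Lp.coeFn_smul c f, hf.ae_eq] with x hx hu
  simp [hx, hu]

theorem isACRep_zero : IsACRep 0 0 := by
  refine ⟨(LipschitzWith.const (0 : ℂ)).lipschitzOnWith.absolutelyContinuousOnInterval, ?_,
    Lp.coeFn_zero ..⟩
  have : deriv (0 : ℝ → ℂ) = 0 := by ext x; simp
  rw [this]
  exact MemLp.zero

/-- The absolutely continuous representative is unique on `[0, 1]`. -/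
theorem IsACRep.eqOn {f : L2} {u v : ℝ → ℂ} (hu : IsACRep f u) (hv : IsACRep f v) :
    EqOn u v (Icc 0 1) := by
  have h : u =ᵐ[volume.restrict (Icc 0 1)] v := by
    rw [← restrict_Ioo_eq_restrict_Icc]
    exact hu.ae_eq.symm.trans hv.ae_eq
  refine Measure.eqOn_Icc_of_ae_eq volume zero_ne_one h ?_ ?_
  · simpa [uIcc_of_le] using hu.ac.continuousOn
  · simpa [uIcc_of_le] using hv.ac.continuousOn

theorem IsACRep.deriv_ae_eq {f : L2} {u v : ℝ → ℂ} (hu : IsACRep f u) (hv : IsACRep f v) :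
    deriv u =ᵐ[μ01] deriv v := by
  refine (ae_restrict_iff' measurableSet_Ioo).2 (.of_forall fun x hx => ?_)
  refine Filter.EventuallyEq.deriv_eq ?_
  filter_upwards [isOpen_Ioo.mem_nhds hx] with y hy
  exact hu.eqOn hv (Ioo_subset_Icc_self hy)

/-- `D`: the absolutely continuous `f ∈ L₂(0, 1)` with `f' ∈ L₂(0, 1)`. -/
def D : Submodule ℂ L2 where
  carrier := {f | ∃ u, IsACRep f u}
  add_mem' := fun ⟨u, hu⟩ ⟨v, hv⟩ => ⟨u + v, (hu.add hv).1⟩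
  zero_mem' := ⟨0, isACRep_zero⟩
  smul_mem' := fun c _ ⟨u, hu⟩ => ⟨c • u, (hu.smul c).1⟩

/-- `D₀`: the `f ∈ D` with `f(0) = f(1)`. -/
def D₀ : Submodule ℂ L2 where
  carrier := {f | ∃ u, IsACRep f u ∧ u 0 = u 1}
  add_mem' := fun ⟨u, hu, hu'⟩ ⟨v, hv, hv'⟩ => ⟨u + v, (hu.add hv).1, by simp [hu', hv']⟩
  zero_mem' := ⟨0, isACRep_zero, rfl⟩
  smul_mem' := fun c _ ⟨u, hu, hu'⟩ => ⟨c • u, (hu.smul c).1, by simp [hu']⟩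

/-- `D₀₀`: the `f ∈ D` with `f(0) = f(1) = 0`. -/
def D₀₀ : Submodule ℂ L2 where
  carrier := {f | ∃ u, IsACRep f u ∧ u 0 = 0 ∧ u 1 = 0}
  add_mem' := fun ⟨u, hu, hu0, hu1⟩ ⟨v, hv, hv0, hv1⟩ =>
    ⟨u + v, (hu.add hv).1, by simp [hu0, hv0], by simp [hu1, hv1]⟩
  zero_mem' := ⟨0, isACRep_zero, rfl, rfl⟩
  smul_mem' := fun c _ ⟨u, hu, hu0, hu1⟩ => ⟨c • u, (hu.smul c).1, by simp [hu0], by simp [hu1]⟩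

theorem D₀_le_D : D₀ ≤ D := fun _ ⟨u, hu, _⟩ => ⟨u, hu⟩

theorem D₀₀_le_D : D₀₀ ≤ D := fun _ ⟨u, hu, _⟩ => ⟨u, hu⟩

open Classical in
/-- The derivative `f' ∈ L₂(0, 1)` of `f ∈ D` (and `0` for `f ∉ D`). -/
def derivL2 (f : L2) : L2 :=
  if h : ∃ u, IsACRep f u then h.choose_spec.memLp_deriv.toLp _ else 0

theorem IsACRep.derivL2_ae_eq {f : L2} {u : ℝ → ℂ} (h : IsACRep f u) :
    derivL2 f =ᵐ[μ01] deriv u := by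
  have h' : ∃ u, IsACRep f u := ⟨u, h⟩
  rw [derivL2, dif_pos h']
  exact (MemLp.coeFn_toLp _).trans (h'.choose_spec.deriv_ae_eq h)

theorem derivL2_add {f g : L2} (hf : f ∈ D) (hg : g ∈ D) :
    derivL2 (f + g) = derivL2 f + derivL2 g := by
  obtain ⟨u, hu⟩ := hf
  obtain ⟨v, hv⟩ := hg
  apply Lp.ext
  filter_upwards [(hu.add hv).1.derivL2_ae_eq, (hu.add hv).2, hu.derivL2_ae_eq,
    hv.derivL2_ae_eq, Lp.coeFn_add (derivL2 f) (derivL2 g)] with x h1 h2 h3 h4 h5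
  rw [h1, h2, h5, Pi.add_apply, Pi.add_apply, h3, h4]

theorem derivL2_smul (c : ℂ) {f : L2} (hf : f ∈ D) : derivL2 (c • f) = c • derivL2 f := by
  obtain ⟨u, hu⟩ := hf
  apply Lp.ext
  filter_upwards [(hu.smul c).1.derivL2_ae_eq, (hu.smul c).2, hu.derivL2_ae_eq,
    Lp.coeFn_smul c (derivL2 f)] with x h1 h2 h3 h4
  simp [h1, h2, h3, h4]

/-- The Hilbert module `C[0, 1] ⊗ L₂(0, 1) = C([0, 1], L₂(0, 1))` over `C[0, 1]`. -/
abbrev tModule : Type := C(unitInterval, L2)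

theorem mem_D_of_fibres {f : tModule} (h0 : f 0 ∈ D₀₀)
    (h1 : ∀ p : unitInterval, 0 < p → f p ∈ D₀) (p : unitInterval) : f p ∈ D := by
  rcases eq_or_lt_of_le (show 0 ≤ p from bot_le) with rfl | hp
  · exact D₀₀_le_D h0
  · exact D₀_le_D (h1 p hp)

/-- The domain of `t`. -/
def tDomain : Submodule ℂ tModule where
  carrier := {f | f 0 ∈ D₀₀ ∧ (∀ p : unitInterval, 0 < p → f p ∈ D₀) ∧
    Continuous fun p => derivL2 (f p)}
  add_mem' := fun {f g} ⟨hf0, hf1, hf⟩ ⟨hg0, hg1, hg⟩ =>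
    ⟨D₀₀.add_mem hf0 hg0, fun p hp => D₀.add_mem (hf1 p hp) (hg1 p hp), by
      simp only [ContinuousMap.add_apply, derivL2_add (mem_D_of_fibres hf0 hf1 _)
        (mem_D_of_fibres hg0 hg1 _)]
      exact hf.add hg⟩
  zero_mem' := ⟨D₀₀.zero_mem, fun _ _ => D₀.zero_mem,
    continuous_const (y := derivL2 0)⟩
  smul_mem' := fun c f ⟨hf0, hf1, hf⟩ =>
    ⟨D₀₀.smul_mem c hf0, fun p hp => D₀.smul_mem c (hf1 p hp), by
      simp only [ContinuousMap.smul_apply, derivL2_smul c (mem_D_of_fibres hf0 hf1 _)]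
      exact hf.const_smul c⟩

theorem tDomain_continuous (f : tDomain) : Continuous fun p => derivL2 (f.1 p) := f.2.2.2

theorem tDomain_mem_D (f : tDomain) (p : unitInterval) : f.1 p ∈ D :=
  mem_D_of_fibres f.2.1 f.2.2.1 p

/-- The operator `t`: `(t f)(p) = i (f p)'`. -/
def t : tModule →ₗ.[ℂ] tModule where
  domain := tDomain
  toFun :=
    { toFun := fun f =>
        ⟨fun p => Complex.I • derivL2 (f.1 p), (tDomain_continuous f).const_smul Complex.I⟩
      map_add' := fun f g => by
        ext1 p
        simp [derivL2_add (tDomain_mem_D f p) (tDomain_mem_D g p)]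
      map_smul' := fun c f => by
        ext1 p
        simp [derivL2_smul c (tDomain_mem_D f p), smul_comm c Complex.I] }

end HilbertModule

end

noncomputable section

namespace HilbertModule

/-! ### Absolutely continuous functions -/

/-! Let `S` be `i d/dx` on `D₀` and `S₀` its restriction to `D₀₀`. `S` is self-adjoint, and `t` is
the constant field of operators `S` over [0, 1], except that its fibre at 0 is cut down to `S₀`. The
adjoint does not see this: testing with `p ↦ p • q`, for `q` in the graph of `S`, fixes `t*` in
every fibre `p ≠ 0`, and continuity together with closedness of the graph of `S` extends this to 0
(`adjointGraph_eq`). So `t*` is the constant field `S`; it is self-adjoint, and it is regular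
because the bounded solution operator of `(1 + S²) f = y` can be applied fibrewise
(`exists_resolvent`).

On the other hand, the fibre of `1 + t*t` at 0 lies in `1 + S S₀`, whose range stays at distance at
least 1/2 from the constant function 1 (`t_not_isRegular`). The core property survives since `D₀₀`
imposes an extra condition on the values of `f` but none on `f'` beyond orthogonality to 1, so the
derivative can be moved into the domain of `t*` by a small perturbation
(`exists_mem_comp_domain_dist_lt`).

Everything is computed on graphs. With `V` the Volterra operator, the graph of `S` consists of the
pairs `(c • 1 + V(-i h), h)` with `h ⟂ 1`, and `S₀` is the case `c = 0`; integration by parts then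
becomes the identity `inner_volterra_add`. -/

theorem absolutelyContinuousOnInterval_of_dist_le {X Y : Type*} [PseudoMetricSpace X]
    [PseudoMetricSpace Y] {u : ℝ → X} {v : ℝ → Y} {a b : ℝ}
    (hv : AbsolutelyContinuousOnInterval v a b)
    (h : ∀ x ∈ uIcc a b, ∀ y ∈ uIcc a b, dist (u x) (u y) ≤ dist (v x) (v y)) :
    AbsolutelyContinuousOnInterval u a b := by
  rw [absolutelyContinuousOnInterval_iff] at hv ⊢
  intro ε hε
  obtain ⟨δ, hδ, H⟩ := hv ε hε
  refine ⟨δ, hδ, fun I hI hI' => lt_of_le_of_lt (Finset.sum_le_sum fun i hi => ?_) (H I hI hI')⟩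
  exact h _ (hI.1 i hi).1 _ (hI.1 i hi).2

/-- The increments are dominated by those of the real primitive of `‖w‖`. -/
theorem absolutelyContinuousOnInterval_integral {w : ℝ → ℂ}
    (hw : IntervalIntegrable w volume 0 1) :
    AbsolutelyContinuousOnInterval (fun x => ∫ s in (0 : ℝ)..x, w s) 0 1 := by
  refine absolutelyContinuousOnInterval_of_dist_le
    (hw.norm.absolutelyContinuousOnInterval_intervalIntegral left_mem_uIcc) fun x hx y hy => ?_
  have hint : ∀ z ∈ uIcc (0 : ℝ) 1, IntervalIntegrable w volume 0 z := fun z hz =>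
    hw.mono_set (uIcc_subset_uIcc_left hz)
  rw [dist_eq_norm, dist_eq_norm, intervalIntegral.integral_interval_sub_left (hint x hx) (hint y hy),
    intervalIntegral.integral_interval_sub_left (hint x hx).norm (hint y hy).norm]
  exact intervalIntegral.norm_integral_le_abs_integral_norm

/-- The fundamental theorem of calculus for absolutely continuous complex functions. -/
theorem eq_add_integral_of_absolutelyContinuous {u w : ℝ → ℂ}
    (hu : AbsolutelyContinuousOnInterval u 0 1) (hw : IntervalIntegrable w volume 0 1)
    (h : ∀ᵐ x, x ∈ uIcc (0 : ℝ) 1 → HasDerivAt u (w x) x) :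
    ∀ x ∈ Icc (0 : ℝ) 1, u x = u 0 + ∫ s in (0 : ℝ)..x, w s := by
  -- The difference of `u` and the primitive of `w` is absolutely continuous with derivative 0
  -- almost everywhere, hence constant.
  obtain ⟨C, hC⟩ := (hu.sub (absolutelyContinuousOnInterval_integral hw)).const_of_ae_hasDerivAt_zero
    (by
      filter_upwards [h, hw.ae_hasDerivAt_integral] with x h1 h2 hx
      simpa using (h1 hx).sub (h2 hx 0 left_mem_uIcc))
  intro x hx
  have h0 := hC 0 left_mem_uIcc
  have h1 := hC x (by rwa [uIcc_of_le zero_le_one])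
  simp only [Pi.sub_apply, intervalIntegral.integral_same, sub_zero] at h0 h1
  rw [h0, ← h1]; ring

theorem ae_uIcc_iff {q : ℝ → Prop} :
    (∀ᵐ x, x ∈ uIcc (0 : ℝ) 1 → q x) ↔ ∀ᵐ x ∂μ01, q x := by
  rw [μ01, restrict_Ioo_eq_restrict_Icc, ae_restrict_iff' measurableSet_Icc,
    uIcc_of_le zero_le_one]

theorem intervalIntegrable_iff_μ01 {w : ℝ → ℂ} :
    IntervalIntegrable w volume 0 1 ↔ Integrable w μ01 :=
  intervalIntegrable_iff_integrableOn_Ioo_of_le zero_le_one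

theorem intervalIntegral_eq_μ01 (w : ℝ → ℂ) : ∫ s in (0 : ℝ)..1, w s = ∫ s, w s ∂μ01 := by
  rw [intervalIntegral.integral_of_le zero_le_one, integral_Ioc_eq_integral_Ioo]

instance : IsProbabilityMeasure μ01 := ⟨by simp⟩

/-! ### The Volterra operator -/

/-- The constant function `1` in `L₂(0, 1)`. -/
def oneL2 : L2 := Lp.const 2 μ01 (1 : ℂ)

theorem oneL2_ae_eq : oneL2 =ᵐ[μ01] fun _ => (1 : ℂ) := Lp.coeFn_const ..

theorem inner_oneL2 (g : L2) : ⟪oneL2, g⟫_ℂ = ∫ s, g s ∂μ01 := by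
  rw [L2.inner_def]
  refine integral_congr_ae ?_
  filter_upwards [oneL2_ae_eq] with x hx
  simp [hx]

theorem inner_oneL2_self : ⟪oneL2, oneL2⟫_ℂ = 1 := by
  rw [inner_oneL2, integral_congr_ae oneL2_ae_eq]
  simp

theorem norm_oneL2 : ‖oneL2‖ = 1 := by
  have h := inner_oneL2_self
  rw [inner_self_eq_norm_sq_to_K] at h
  have h' : ‖oneL2‖ ^ 2 = 1 := by
    have := congrArg Complex.re h
    simpa [← Complex.ofReal_pow] using this
  nlinarith [norm_nonneg oneL2]

theorem integrable_L2 (g : L2) : Integrable g μ01 := (Lp.memLp g).integrable (by norm_num)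

/-- The primitive of `g ∈ L₂(0, 1)` which vanishes at `0`. -/
def primitive (g : L2) (x : ℝ) : ℂ := ∫ s in (0 : ℝ)..x, g s

theorem primitive_zero (g : L2) : primitive g 0 = 0 := intervalIntegral.integral_same

theorem primitive_one (g : L2) : primitive g 1 = ⟪oneL2, g⟫_ℂ := by
  rw [inner_oneL2, primitive, intervalIntegral_eq_μ01]

theorem primitive_ac (g : L2) : AbsolutelyContinuousOnInterval (primitive g) 0 1 :=
  absolutelyContinuousOnInterval_integral (intervalIntegrable_iff_μ01.2 (integrable_L2 g))

theorem primitive_hasDerivAt (g : L2) : ∀ᵐ x ∂μ01, HasDerivAt (primitive g) (g x) x := by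
  rw [← ae_uIcc_iff]
  filter_upwards [(intervalIntegrable_iff_μ01.2 (integrable_L2 g)).ae_hasDerivAt_integral]
    with x h hx using h hx 0 left_mem_uIcc

theorem norm_primitive_le (g : L2) {x : ℝ} (hx : x ∈ Icc (0 : ℝ) 1) : ‖primitive g x‖ ≤ ‖g‖ := by
  have h1 : ‖primitive g x‖ ≤ ∫ s, ‖g s‖ ∂μ01 := by
    refine (intervalIntegral.norm_integral_le_integral_norm hx.1).trans ?_
    rw [intervalIntegral.integral_of_le hx.1, integral_Ioc_eq_integral_Ioo]
    exact setIntegral_mono_set (integrable_L2 g).norm (.of_forall fun _ => norm_nonneg _)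
      (Ioo_subset_Ioo_right hx.2).eventuallyLE
  have h2 : eLpNorm g 1 μ01 ≤ eLpNorm g 2 μ01 :=
    eLpNorm_le_eLpNorm_of_exponent_le (by norm_num) (Lp.aestronglyMeasurable g)
  have h3 : ∫ s, ‖g s‖ ∂μ01 = (eLpNorm g 1 μ01).toReal := by
    rw [eLpNorm_one_eq_lintegral_enorm, integral_norm_eq_lintegral_enorm (Lp.aestronglyMeasurable g)]
  rw [h3] at h1
  exact h1.trans (ENNReal.toReal_mono (Lp.eLpNorm_ne_top g) h2)

theorem primitive_memLp (g : L2) : MemLp (primitive g) 2 μ01 := by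
  have hc : ContinuousOn (primitive g) (Ioo 0 1) := (primitive_ac g).continuousOn.mono (by
    rw [uIcc_of_le zero_le_one]; exact Ioo_subset_Icc_self)
  refine MemLp.of_bound (hc.aestronglyMeasurable measurableSet_Ioo) ‖g‖ ?_
  rw [ae_restrict_iff' measurableSet_Ioo]
  exact .of_forall fun x hx => norm_primitive_le g (Ioo_subset_Icc_self hx)

theorem primitive_congr {g : L2} {w : ℝ → ℂ} (h : g =ᵐ[μ01] w) {x : ℝ} (hx : x ∈ Icc (0 : ℝ) 1) :
    primitive g x = ∫ s in (0 : ℝ)..x, w s := by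
  refine intervalIntegral.integral_congr_ae ?_
  filter_upwards [ae_uIcc_iff.2 h] with s hs hs'
  refine hs (uIcc_subset_uIcc_left ?_ (uIoc_subset_uIcc hs'))
  rwa [uIcc_of_le zero_le_one]

/-- The Volterra operator `(V g)(x) = ∫₀ˣ g`. -/
def volterra : L2 →L[ℂ] L2 :=
  LinearMap.mkContinuous
    { toFun := fun g => (primitive_memLp g).toLp _
      map_add' := fun g h => by
        rw [← MemLp.toLp_add]
        refine MemLp.toLp_congr _ _ ((ae_restrict_iff' measurableSet_Ioo).2 (.of_forall fun x hx => ?_))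
        have hx' := Ioo_subset_Icc_self hx
        have hi : ∀ g : L2, IntervalIntegrable g volume 0 x := fun g =>
          (intervalIntegrable_iff_μ01.2 (integrable_L2 g)).mono_set
            (uIcc_subset_uIcc_left (by rwa [uIcc_of_le zero_le_one]))
        rw [primitive_congr (Lp.coeFn_add g h) hx']
        exact intervalIntegral.integral_add (hi g) (hi h)
      map_smul' := fun c g => by
        rw [RingHom.id_apply, ← MemLp.toLp_const_smul]
        refine MemLp.toLp_congr _ _ ((ae_restrict_iff' measurableSet_Ioo).2 (.of_forall fun x hx => ?_))
        rw [primitive_congr (Lp.coeFn_smul c g) (Ioo_subset_Icc_self hx)]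
        exact intervalIntegral.integral_smul c _ }
    1 fun g => by
      have : ∀ᵐ x ∂μ01, ‖(primitive_memLp g).toLp _ x‖ ≤ ‖g‖ := by
        filter_upwards [(primitive_memLp g).coeFn_toLp, ae_restrict_mem measurableSet_Ioo] with x h hx
        rw [h]
        exact norm_primitive_le g (Ioo_subset_Icc_self hx)
      refine (Lp.norm_le_of_ae_bound (norm_nonneg g) this).trans_eq ?_
      simp [measureUnivNNReal]

theorem volterra_ae_eq (g : L2) : volterra g =ᵐ[μ01] primitive g := (primitive_memLp g).coeFn_toLp

theorem isACRep_volterra (c : ℂ) (g : L2) :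
    IsACRep (c • oneL2 + volterra g) (fun x => c + primitive g x) := by
  have hd : deriv (fun x => c + primitive g x) =ᵐ[μ01] g := by
    filter_upwards [primitive_hasDerivAt g] with x hx using (hx.const_add c).deriv
  refine ⟨?_, (memLp_congr_ae hd).2 (Lp.memLp g), ?_⟩
  · exact (LipschitzWith.const c).lipschitzOnWith.absolutelyContinuousOnInterval.add (primitive_ac g)
  · filter_upwards [Lp.coeFn_add (c • oneL2) (volterra g), Lp.coeFn_smul c oneL2, oneL2_ae_eq,
      volterra_ae_eq g] with x h1 h2 h3 h4
    rw [h1, Pi.add_apply, h2, Pi.smul_apply, h3, h4, smul_eq_mul, mul_one]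

theorem derivL2_volterra (c : ℂ) (g : L2) : derivL2 (c • oneL2 + volterra g) = g := by
  refine Lp.ext ?_
  filter_upwards [(isACRep_volterra c g).derivL2_ae_eq, primitive_hasDerivAt g] with x h hx
  rw [h, (hx.const_add c).deriv]

theorem IsACRep.eq_add_primitive {f : L2} {u : ℝ → ℂ} (h : IsACRep f u) :
    ∀ x ∈ Icc (0 : ℝ) 1, u x = u 0 + primitive (derivL2 f) x := by
  refine eq_add_integral_of_absolutelyContinuous h.ac
    (intervalIntegrable_iff_μ01.2 (integrable_L2 _)) (ae_uIcc_iff.2 ?_)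
  filter_upwards [h.ae_differentiableAt, h.derivL2_ae_eq] with x h1 h2
  rw [h2]
  exact h1.hasDerivAt

theorem IsACRep.eq_volterra {f : L2} {u : ℝ → ℂ} (h : IsACRep f u) :
    f = u 0 • oneL2 + volterra (derivL2 f) := by
  refine Lp.ext ?_
  filter_upwards [h.ae_eq, (isACRep_volterra (u 0) (derivL2 f)).ae_eq,
    ae_restrict_mem measurableSet_Ioo] with x h1 h2 hx
  rw [h1, h2, h.eq_add_primitive x (Ioo_subset_Icc_self hx)]

/-- Since `u 1 = u 0 + ⟪1, f'⟫`, periodicity is orthogonality of the derivative to 1, while the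
value `c = u 0` stays free. -/
theorem mem_D₀_iff {f : L2} :
    f ∈ D₀ ↔ ⟪oneL2, derivL2 f⟫_ℂ = 0 ∧ ∃ c : ℂ, f = c • oneL2 + volterra (derivL2 f) := by
  constructor
  · rintro ⟨u, hu, h⟩
    refine ⟨?_, u 0, hu.eq_volterra⟩
    have := hu.eq_add_primitive 1 (right_mem_Icc.2 zero_le_one)
    rw [← h, primitive_one] at this
    simpa using this
  · rintro ⟨h, c, hc⟩
    have := isACRep_volterra c (derivL2 f)
    rw [← hc] at this
    refine ⟨_, this, ?_⟩
    simp [primitive_zero, primitive_one, h]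

theorem mem_D₀₀_iff {f : L2} :
    f ∈ D₀₀ ↔ ⟪oneL2, derivL2 f⟫_ℂ = 0 ∧ f = volterra (derivL2 f) := by
  constructor
  · rintro ⟨u, hu, h0, h1⟩
    refine ⟨(mem_D₀_iff.1 ⟨u, hu, h0.trans h1.symm⟩).1, ?_⟩
    simpa [h0] using hu.eq_volterra
  · rintro ⟨h, hf⟩
    have := isACRep_volterra 0 (derivL2 f)
    rw [zero_smul, zero_add, ← hf] at this
    exact ⟨_, this, by simp [primitive_zero], by simp [primitive_one, h]⟩

/-- Integration by parts. -/
theorem inner_volterra_add (g h : L2) :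
    ⟪volterra g, h⟫_ℂ + ⟪g, volterra h⟫_ℂ = ⟪g, oneL2⟫_ℂ * ⟪oneL2, h⟫_ℂ := by
  have hconj : AbsolutelyContinuousOnInterval (fun x => star (primitive g x)) 0 1 :=
    absolutelyContinuousOnInterval_of_dist_le (primitive_ac g) fun x _ y _ => by
      rw [dist_star_star]
  have hint : Integrable (fun x => ⟪volterra g x, h x⟫_ℂ + ⟪g x, volterra h x⟫_ℂ) μ01 :=
    (L2.integrable_inner _ _).add (L2.integrable_inner _ _)
  -- The product of the conjugate primitive of `g` and the primitive of `h` vanishes at 0; its value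
  -- at 1 is the right-hand side.
  have key := eq_add_integral_of_absolutelyContinuous (hconj.smul (primitive_ac h))
    (intervalIntegrable_iff_μ01.2 hint) (ae_uIcc_iff.2 (by
      filter_upwards [primitive_hasDerivAt g, primitive_hasDerivAt h, volterra_ae_eq g,
        volterra_ae_eq h] with x h1 h2 h3 h4
      have := h1.star.mul h2
      rw [h3, h4]
      convert! this using 1
      simp only [RCLike.inner_apply, starRingEnd_apply]
      ring)) 1 (right_mem_Icc.2 zero_le_one)
  rw [intervalIntegral_eq_μ01, integral_add (L2.integrable_inner _ _) (L2.integrable_inner _ _),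
    ← L2.inner_def, ← L2.inner_def] at key
  simp only [Pi.smul_apply', primitive_zero, primitive_one, smul_eq_mul, mul_zero, zero_add] at key
  rw [← key, ← starRingEnd_apply, inner_conj_symm]

end HilbertModule

end

noncomputable section

namespace HilbertModule

theorem norm_volterra_le (g : L2) : ‖volterra g‖ ≤ ‖g‖ := by
  simpa using volterra.le_of_opNorm_le (LinearMap.mkContinuous_norm_le _ zero_le_one _) g

/-! ### The graphs of `i d/dx` on `D₀` and on `D₀₀` -/

/-- The graph of `i d/dx` with domain `D₀`. -/
def periodicGraph : Submodule ℂ (L2 × L2) where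
  carrier := {q | ⟪oneL2, q.2⟫_ℂ = 0 ∧ ∃ c : ℂ, q.1 = c • oneL2 + volterra (-Complex.I • q.2)}
  add_mem' {q r} := fun ⟨hq, c, hc⟩ ⟨hr, d, hd⟩ => ⟨by simp [inner_add_right, hq, hr], c + d, by
    rw [Prod.fst_add, Prod.snd_add, hc, hd, smul_add, map_add, add_smul]; abel⟩
  zero_mem' := ⟨by simp, 0, by simp⟩
  smul_mem' a q := fun ⟨hq, c, hc⟩ => ⟨by simp [inner_smul_right, hq], a * c, by
    rw [Prod.smul_fst, Prod.smul_snd, hc, smul_comm (-Complex.I), map_smul volterra a, smul_add, mul_smul]⟩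

/-- The graph of `i d/dx` with domain `D₀₀`. -/
def vanishingGraph : Submodule ℂ (L2 × L2) where
  carrier := {q | ⟪oneL2, q.2⟫_ℂ = 0 ∧ q.1 = volterra (-Complex.I • q.2)}
  add_mem' {q r} := fun ⟨hq, hc⟩ ⟨hr, hd⟩ => ⟨by simp [inner_add_right, hq, hr], by
    rw [Prod.fst_add, Prod.snd_add, hc, hd, smul_add, map_add]⟩
  zero_mem' := ⟨by simp, by simp⟩
  smul_mem' a q := fun ⟨hq, hc⟩ => ⟨by simp [inner_smul_right, hq], by
    rw [Prod.smul_fst, Prod.smul_snd, hc, smul_comm (-Complex.I), map_smul volterra a]⟩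

theorem mem_periodicGraph {f h : L2} : (f, h) ∈ periodicGraph ↔
    ⟪oneL2, h⟫_ℂ = 0 ∧ ∃ c : ℂ, f = c • oneL2 + volterra (-Complex.I • h) := Iff.rfl

theorem mem_vanishingGraph {f h : L2} : (f, h) ∈ vanishingGraph ↔
    ⟪oneL2, h⟫_ℂ = 0 ∧ f = volterra (-Complex.I • h) := Iff.rfl

theorem vanishingGraph_le : vanishingGraph ≤ periodicGraph := fun _ ⟨h, h'⟩ =>
  ⟨h, 0, by rw [zero_smul, zero_add, h']⟩

theorem oneL2_mem_periodicGraph : (oneL2, 0) ∈ periodicGraph := ⟨by simp, 1, by simp⟩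

theorem I_smul_neg_I_smul (h : L2) : Complex.I • (-Complex.I • h) = h := by
  rw [smul_smul]; simp

theorem neg_I_smul_I_smul (h : L2) : -Complex.I • (Complex.I • h) = h := by
  rw [smul_smul]; simp

theorem mem_periodicGraph_iff {f h : L2} :
    (f, h) ∈ periodicGraph ↔ f ∈ D₀ ∧ h = Complex.I • derivL2 f := by
  rw [mem_periodicGraph, mem_D₀_iff]
  constructor
  · rintro ⟨h1, c, rfl⟩
    rw [derivL2_volterra, I_smul_neg_I_smul, inner_smul_right, h1, mul_zero]
    exact ⟨⟨rfl, c, rfl⟩, rfl⟩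
  · rintro ⟨⟨h1, c, hc⟩, rfl⟩
    rw [inner_smul_right, h1, neg_I_smul_I_smul, mul_zero]
    exact ⟨rfl, c, hc⟩

theorem mem_vanishingGraph_iff {f h : L2} :
    (f, h) ∈ vanishingGraph ↔ f ∈ D₀₀ ∧ h = Complex.I • derivL2 f := by
  rw [mem_vanishingGraph, mem_D₀₀_iff]
  constructor
  · rintro ⟨h1, rfl⟩
    have := derivL2_volterra 0 (-Complex.I • h)
    rw [zero_smul, zero_add] at this
    rw [this, I_smul_neg_I_smul, inner_smul_right, h1, mul_zero]
    exact ⟨⟨rfl, rfl⟩, rfl⟩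
  · rintro ⟨⟨h1, hf⟩, rfl⟩
    rw [inner_smul_right, h1, neg_I_smul_I_smul, mul_zero]
    exact ⟨rfl, hf⟩

/-- The component of `u` orthogonal to 1 is itself an admissible `v`, so it is orthogonal to itself.
-/
theorem eq_smul_oneL2_of_forall_inner_eq_zero {u : L2}
    (h : ∀ v : L2, ⟪oneL2, v⟫_ℂ = 0 → ⟪v, u⟫_ℂ = 0) : u = ⟪oneL2, u⟫_ℂ • oneL2 := by
  rw [← sub_eq_zero]
  have h1 : ⟪oneL2, u - ⟪oneL2, u⟫_ℂ • oneL2⟫_ℂ = 0 := by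
    rw [inner_sub_right, inner_smul_right, inner_oneL2_self, mul_one, sub_self]
  rw [← inner_self_eq_zero (𝕜 := ℂ)]
  nth_rewrite 2 [sub_eq_add_neg]
  rw [inner_add_right, h _ h1, inner_neg_right, inner_smul_right, ← inner_conj_symm _ oneL2, h1]
  simp

theorem inner_volterra_of_inner_eq_zero {v : L2} (hv : ⟪oneL2, v⟫_ℂ = 0) (z : L2) :
    ⟪volterra v, z⟫_ℂ = -⟪v, volterra z⟫_ℂ := by
  rw [eq_neg_iff_add_eq_zero, inner_volterra_add, ← inner_conj_symm v, hv]
  simp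

/-- The operator `i d/dx` on `D₀` is self-adjoint. -/
theorem mem_periodicGraph_iff_forall {y z : L2} : (y, z) ∈ periodicGraph ↔
    ∀ q ∈ periodicGraph, ⟪q.2, y⟫_ℂ = ⟪q.1, z⟫_ℂ := by
  constructor
  · rintro ⟨hz, c, hc⟩ ⟨f, h⟩ ⟨hh, d, hd⟩
    dsimp only at hz hc hh hd ⊢
    rw [hc, hd, inner_add_right, inner_add_left, inner_smul_right, inner_smul_left, hz,
      ← inner_conj_symm h oneL2, hh, map_smul, map_smul, inner_smul_left, inner_smul_right,
      inner_volterra_of_inner_eq_zero hh]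
    simp
  · intro H
    -- Constants lie in the kernel of the operator; testing with them gives the boundary condition.
    have hz : ⟪oneL2, z⟫_ℂ = 0 := by simpa using (H _ oneL2_mem_periodicGraph).symm
    -- Testing with `(V(-i v), v)` for all `v ⟂ 1` shows that `y - V(-i z)` is constant.
    refine ⟨hz, _, sub_eq_iff_eq_add.1 (eq_smul_oneL2_of_forall_inner_eq_zero fun v hv => ?_)⟩
    have := H _ (vanishingGraph_le (mem_vanishingGraph.2 ⟨hv, rfl⟩))
    rw [map_smul, inner_smul_left, inner_volterra_of_inner_eq_zero hv] at this
    rw [inner_sub_right, this, map_smul, inner_smul_right]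
    simp

theorem isClosed_periodicGraph : IsClosed (periodicGraph : Set (L2 × L2)) := by
  have : (periodicGraph : Set (L2 × L2)) =
      ⋂ q ∈ periodicGraph, {r : L2 × L2 | ⟪q.2, r.1⟫_ℂ = ⟪q.1, r.2⟫_ℂ} := by
    ext ⟨y, z⟩
    simpa using! mem_periodicGraph_iff_forall
  rw [this]
  exact isClosed_biInter fun q _ => isClosed_eq (by fun_prop) (by fun_prop)

theorem isClosed_vanishingGraph : IsClosed (vanishingGraph : Set (L2 × L2)) :=
  (isClosed_eq (f := fun q : L2 × L2 => ⟪oneL2, q.2⟫_ℂ) (by fun_prop) (by fun_prop)).inter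
    (isClosed_eq (g := fun q : L2 × L2 => volterra (-Complex.I • q.2)) (by fun_prop) (by fun_prop))

/-- Here `c = S² a` and `b = S a`, so symmetry gives `‖a‖² + ‖b‖² = re ⟪a, a + c⟫ ≤ ‖a‖ ‖a + c‖`. -/
theorem norm_le_of_mem_periodicGraph {a b c : L2} (hab : (a, b) ∈ periodicGraph)
    (hbc : (b, c) ∈ periodicGraph) : ‖a‖ ≤ ‖a + c‖ ∧ ‖b‖ ≤ ‖a + c‖ := by
  have h1 : ⟪b, b⟫_ℂ = ⟪a, c⟫_ℂ := mem_periodicGraph_iff_forall.1 hbc _ hab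
  have h2 : ‖a‖ ^ 2 + ‖b‖ ^ 2 ≤ ‖a‖ * ‖a + c‖ := by
    refine le_trans (le_of_eq ?_) (re_inner_le_norm (𝕜 := ℂ) a (a + c))
    rw [inner_add_right, ← h1, map_add, inner_self_eq_norm_sq, inner_self_eq_norm_sq]
  have h3 : ‖a‖ ≤ ‖a + c‖ := by
    by_contra! h
    nlinarith [norm_nonneg a, norm_nonneg (a + c), sq_nonneg ‖b‖]
  refine ⟨h3, abs_le_of_sq_le_sq' ?_ (norm_nonneg _) |>.2⟩
  nlinarith [norm_nonneg (a + c), sq_nonneg ‖a‖]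

theorem dense_fst_vanishingGraph (y : L2) {ε : ℝ} (hε : 0 < ε) :
    ∃ q ∈ vanishingGraph, dist q.1 y < ε := by
  have : (vanishingGraph.map (LinearMap.fst ℂ L2 L2)).topologicalClosure = ⊤ := by
    rw [Submodule.topologicalClosure_eq_top_iff, eq_bot_iff]
    intro z hz
    -- If `z` is orthogonal to the domain, then `V z` is constant; its derivative is both `z` and 0.
    have h1 : volterra z = ⟪oneL2, volterra z⟫_ℂ • oneL2 := by
      refine eq_smul_oneL2_of_forall_inner_eq_zero fun v hv => ?_
      have := hz _ (Submodule.mem_map_of_mem (mem_vanishingGraph.2 ⟨hv, rfl⟩))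
      rw [LinearMap.fst_apply, map_smul, inner_smul_left, inner_volterra_of_inner_eq_zero hv] at this
      simpa using this
    have h2 := derivL2_volterra 0 z
    have h3 := derivL2_volterra ⟪oneL2, volterra z⟫_ℂ 0
    rw [zero_smul, zero_add, h1] at h2
    rw [map_zero, add_zero] at h3
    exact h2.symm.trans h3
  have hy : y ∈ closure ((vanishingGraph.map (LinearMap.fst ℂ L2 L2) : Submodule ℂ L2) : Set L2) := by
    rw [← Submodule.topologicalClosure_coe, this]
    trivial
  obtain ⟨_, ⟨q, hq, rfl⟩, h⟩ := Metric.mem_closure_iff.1 hy ε hε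
  exact ⟨q, hq, by rwa [dist_comm]⟩

/-- The solution operator of `(1 + T²) f = y`, where `T` is `i d/dx` on `D₀`. -/
theorem exists_resolvent : ∃ R Q : L2 →L[ℂ] L2, ∀ y, (R y, Q y) ∈ periodicGraph ∧
    (Q y, y - R y) ∈ periodicGraph := by
  -- `(R y, Q y)` is the orthogonal projection of `(y, 0)` onto the closed graph. The product needs
  -- its Hilbert norm for this.
  let ι := WithLp.prodContinuousLinearEquiv 2 ℂ L2 L2
  let K : Submodule ℂ (WithLp 2 (L2 × L2)) := periodicGraph.comap ι.toLinearMap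
  have hK : IsClosed (K : Set (WithLp 2 (L2 × L2))) := isClosed_periodicGraph.preimage ι.continuous
  have := hK.completeSpace_coe
  let P : L2 →L[ℂ] L2 × L2 := ι.toContinuousLinearMap ∘L K.starProjection ∘L
    ι.symm.toContinuousLinearMap ∘L ContinuousLinearMap.inl ℂ L2 L2
  refine ⟨ContinuousLinearMap.fst ℂ L2 L2 ∘L P, ContinuousLinearMap.snd ℂ L2 L2 ∘L P, fun y => ⟨?_, ?_⟩⟩
  · exact K.starProjection_apply_mem (ι.symm (y, 0))
  · rw [mem_periodicGraph_iff_forall]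
    intro q hq
    have h1 : ι.symm q ∈ K := by
      show ι (ι.symm q) ∈ periodicGraph
      rwa [ι.apply_symm_apply]
    -- The residual `(y - R y, -Q y)` is orthogonal to the graph, which says that `(Q y, y - R y)`
    -- is in the graph of the adjoint.
    have h2 := K.sub_starProjection_mem_orthogonal (ι.symm (y, 0)) _ h1
    rw [WithLp.prod_inner_apply] at h2
    have h3 : ⟪q.1, y - (P y).1⟫_ℂ + ⟪q.2, 0 - (P y).2⟫_ℂ = 0 := h2
    rw [zero_sub, inner_neg_right, add_neg_eq_zero] at h3
    exact h3.symm

/-! ### Operators on `C([0, 1], L₂(0, 1))` -/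

/-- The graph of the operator on `C([0, 1], L₂(0, 1))` which is `i d/dx` on `D₀` in each fibre. -/
def fibrewiseGraph : Submodule ℂ (tModule × tModule) where
  carrier := {q | ∀ p, (q.1 p, q.2 p) ∈ periodicGraph}
  add_mem' hq hr p := periodicGraph.add_mem (hq p) (hr p)
  zero_mem' _ := periodicGraph.zero_mem
  smul_mem' c _ hq p := periodicGraph.smul_mem c (hq p)

theorem mem_fibrewiseGraph {f h : tModule} :
    (f, h) ∈ fibrewiseGraph ↔ ∀ p, (f p, h p) ∈ periodicGraph := Iff.rfl

theorem isClosed_fibrewiseGraph : IsClosed (fibrewiseGraph : Set (tModule × tModule)) := by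
  have : (fibrewiseGraph : Set (tModule × tModule)) =
      ⋂ p, (fun q : tModule × tModule => (q.1 p, q.2 p)) ⁻¹' periodicGraph := by
    ext q
    simp [fibrewiseGraph]
  rw [this]
  exact isClosed_iInter fun p => isClosed_periodicGraph.preimage (by fun_prop)

/-- Continuity of the derivatives `p ↦ (f p)'` is absorbed into `h` being a continuous function. -/
theorem mem_t_graph_iff {f h : tModule} :
    (f, h) ∈ t.graph ↔ (f 0, h 0) ∈ vanishingGraph ∧ (f, h) ∈ fibrewiseGraph := by
  rw [LinearPMap.mem_graph_iff, mem_fibrewiseGraph]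
  constructor
  · rintro ⟨x, hx, hx'⟩
    dsimp only at hx hx'
    subst hx hx'
    have h0 : ((x : tModule) 0, t x 0) ∈ vanishingGraph := mem_vanishingGraph_iff.2 ⟨x.2.1, rfl⟩
    refine ⟨h0, fun p => ?_⟩
    rcases eq_or_lt_of_le (show 0 ≤ p from bot_le) with rfl | hp
    · exact vanishingGraph_le h0
    · exact mem_periodicGraph_iff.2 ⟨x.2.2.1 p hp, rfl⟩
  · rintro ⟨h0, H⟩
    have hd : ∀ p, h p = Complex.I • derivL2 (f p) := fun p => (mem_periodicGraph_iff.1 (H p)).2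
    refine ⟨⟨f, (mem_vanishingGraph_iff.1 h0).1, fun p _ => (mem_periodicGraph_iff.1 (H p)).1, ?_⟩,
      rfl, ?_⟩
    · have : (fun p => derivL2 (f p)) = fun p => -Complex.I • h p := by
        ext1 p
        rw [hd, neg_I_smul_I_smul]
      rw [this]
      fun_prop
    · ext1 p
      exact (hd p).symm

theorem smul_mem_t_graph (a : C(unitInterval, ℂ)) {f h : tModule} (hf : (f, h) ∈ t.graph) :
    (a • f, a • h) ∈ t.graph := by
  rw [mem_t_graph_iff] at hf ⊢
  exact ⟨vanishingGraph.smul_mem (a 0) hf.1, fun p => periodicGraph.smul_mem (a p) (hf.2 p)⟩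

theorem t_isClosed : t.IsClosed := by
  have : (t.graph : Set (tModule × tModule)) =
      (fun q : tModule × tModule => (q.1 0, q.2 0)) ⁻¹' vanishingGraph ∩ fibrewiseGraph := by
    ext ⟨f, h⟩
    exact mem_t_graph_iff
  rw [LinearPMap.IsClosed, this]
  exact (isClosed_vanishingGraph.preimage (by fun_prop)).inter isClosed_fibrewiseGraph

theorem exists_mem_t_graph_dist_lt (y : tModule) {ε : ℝ} (hε : 0 < ε) :
    ∃ f h, (f, h) ∈ t.graph ∧ dist f y < ε := by
  -- Approximants in the smaller graph exist in each fibre and remain good nearby; convexity lets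
  -- them be glued by a partition of unity.
  obtain ⟨g, hg⟩ := exists_continuous_forall_mem_convex_of_local_const
    (t := fun p : unitInterval => {q : L2 × L2 | q ∈ vanishingGraph ∧ dist q.1 (y p) < ε})
    (fun p => by
      have h1 : Convex ℝ (vanishingGraph : Set (L2 × L2)) :=
        (vanishingGraph.restrictScalars ℝ).convex
      have h2 : Convex ℝ (Prod.fst ⁻¹' Metric.ball (y p) ε : Set (L2 × L2)) :=
        (convex_ball (y p) ε).linear_preimage (LinearMap.fst ℝ L2 L2)
      exact h1.inter h2)
    (fun p => by
      obtain ⟨q, hq, h⟩ := dense_fst_vanishingGraph (y p) hε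
      refine ⟨q, ?_⟩
      have : ∀ᶠ r in nhds p, dist q.1 (y r) < ε :=
        (continuous_const.dist y.continuous).continuousAt.eventually_lt_const h
      filter_upwards [this] with r hr using ⟨hq, hr⟩)
  refine ⟨⟨fun p => (g p).1, by fun_prop⟩, ⟨fun p => (g p).2, by fun_prop⟩, ?_, ?_⟩
  · exact mem_t_graph_iff.2 ⟨(hg 0).1, fun p => vanishingGraph_le (hg p).1⟩
  · exact (ContinuousMap.dist_lt_iff hε).2 fun p => (hg p).2

theorem dense_t_domain : Dense (t.domain : Set tModule) := by
  refine Metric.dense_iff.2 fun y ε hε => ?_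
  obtain ⟨f, h, hf, hd⟩ := exists_mem_t_graph_dist_lt y hε
  exact ⟨f, hd, LinearPMap.mem_domain_of_mem_graph hf⟩

/-- An operator between `t` and the fibrewise operator has the fibrewise operator as adjoint. -/
theorem adjointGraph_eq {T : tModule →ₗ.[ℂ] tModule} (h1 : t.graph ≤ T.graph)
    (h2 : T.graph ≤ fibrewiseGraph) : adjointGraph C(unitInterval, ℂ) T = fibrewiseGraph := by
  ext ⟨y, z⟩
  constructor
  · intro H
    have key : ∀ f h, (f, h) ∈ t.graph → ∀ p, ⟪h p, y p⟫_ℂ = ⟪f p, z p⟫_ℂ := by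
      intro f h hf p
      obtain ⟨x, hx, hx'⟩ := (LinearPMap.mem_graph_iff _).1 (h1 hf)
      have := DFunLike.congr_fun (H x) p
      rw [hx, hx'] at this
      exact this
    have hpos : ∀ p : unitInterval, p ≠ 0 → (y p, z p) ∈ periodicGraph := by
      intro p hp
      rw [mem_periodicGraph_iff_forall]
      intro q hq
      -- Vanishing at 0 makes `a • q` satisfy the stricter condition there for every `q`, and `a p ≠
      -- 0` can be cancelled.
      let a : C(unitInterval, ℂ) := ⟨fun r => ((r : ℝ) : ℂ), by fun_prop⟩
      have := key (a • ContinuousMap.const _ q.1) (a • ContinuousMap.const _ q.2)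
        (mem_t_graph_iff.2 ⟨by simp [a, ← Prod.zero_eq_mk],
          fun r => periodicGraph.smul_mem (a r) hq⟩) p
      have hp' : (p : ℝ) ≠ 0 := fun h => hp (Subtype.ext h)
      simpa [a, inner_smul_left, hp'] using this
    have hc : IsClosed {p : unitInterval | (y p, z p) ∈ periodicGraph} :=
      isClosed_periodicGraph.preimage (f := fun p : unitInterval => (y p, z p)) (by fun_prop)
    have hd : Dense {p : unitInterval | (y p, z p) ∈ periodicGraph} :=
      (dense_compl_singleton (0 : unitInterval)).mono fun p hp => hpos p hp
    intro p
    exact hc.closure_subset (hd p)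
  · intro H x
    ext p
    exact mem_periodicGraph_iff_forall.1 (H p) _ (h2 (T.mem_graph x) p)

theorem fibrewiseGraph_toLinearPMap_graph : fibrewiseGraph.toLinearPMap.graph = fibrewiseGraph := by
  refine Submodule.toLinearPMap_graph_eq _ fun q hq hq' => ?_
  ext1 p
  have h := (mem_periodicGraph_iff.1 (hq p)).2
  rw [hq', ContinuousMap.zero_apply, ← zero_smul ℂ (0 : L2), derivL2_smul 0 D.zero_mem] at h
  simpa using h

theorem t_graph_le : t.graph ≤ fibrewiseGraph := fun _ h => (mem_t_graph_iff.1 h).2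

theorem adjoint_t : adjoint C(unitInterval, ℂ) t = fibrewiseGraph.toLinearPMap := by
  rw [adjoint, adjointGraph_eq le_rfl t_graph_le]

theorem adjoint_fibrewise :
    adjoint C(unitInterval, ℂ) fibrewiseGraph.toLinearPMap = fibrewiseGraph.toLinearPMap := by
  rw [adjoint, adjointGraph_eq] <;> rw [fibrewiseGraph_toLinearPMap_graph]
  exact t_graph_le

theorem dense_fibrewise_domain : Dense (fibrewiseGraph.toLinearPMap.domain : Set tModule) := by
  refine dense_t_domain.mono fun f hf => ?_
  refine LinearPMap.mem_domain_of_mem_graph (y := t ⟨f, hf⟩) ?_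
  rw [fibrewiseGraph_toLinearPMap_graph]
  exact t_graph_le (t.mem_graph ⟨f, hf⟩)

theorem mem_comp_graph_iff {E F G : Type*} [NormedAddCommGroup E] [NormedSpace ℂ E]
    [NormedAddCommGroup F] [NormedSpace ℂ F] [NormedAddCommGroup G] [NormedSpace ℂ G]
    {S : F →ₗ.[ℂ] G} {T : E →ₗ.[ℂ] F} {x : E} {z : G} :
    (x, z) ∈ (comp S T).graph ↔ ∃ y, (x, y) ∈ T.graph ∧ (y, z) ∈ S.graph := by
  constructor
  · rw [LinearPMap.mem_graph_iff]
    rintro ⟨⟨_, ⟨x, hx⟩, hxS, rfl⟩, rfl, rfl⟩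
    exact ⟨T ⟨x, hx⟩, T.mem_graph ⟨x, hx⟩, S.mem_graph ⟨T ⟨x, hx⟩, hxS⟩⟩
  · rintro ⟨y, hxy, hyz⟩
    obtain ⟨⟨x, hx⟩, rfl, rfl⟩ := (LinearPMap.mem_graph_iff _).1 hxy
    obtain ⟨⟨y, hy⟩, hyy, rfl⟩ := (LinearPMap.mem_graph_iff _).1 hyz
    dsimp only at hyy
    subst hyy
    exact (LinearPMap.mem_graph_iff _).2 ⟨⟨x, ⟨x, hx⟩, hy, rfl⟩, rfl, rfl⟩

/-! ### Semiregularity, regularity of the adjoint, failure of regularity, and the core -/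

theorem t_isSemiregular : IsSemiregular C(unitInterval, ℂ) t where
  smul_mem a x hx :=
    LinearPMap.mem_domain_of_mem_graph (smul_mem_t_graph a (t.mem_graph ⟨x, hx⟩))
  dense_domain := dense_t_domain
  isClosable := t_isClosed.isClosable
  dense_adjoint_domain := adjoint_t ▸ dense_fibrewise_domain

theorem adjoint_t_isRegular : IsRegular C(unitInterval, ℂ) (adjoint C(unitInterval, ℂ) t) := by
  rw [adjoint_t]
  refine ⟨?_, fun a x hx => ?_, dense_fibrewise_domain, ?_, ?_⟩
  · rw [LinearPMap.IsClosed, fibrewiseGraph_toLinearPMap_graph]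
    exact isClosed_fibrewiseGraph
  · obtain ⟨y, hy⟩ := LinearPMap.mem_domain_iff.1 hx
    rw [fibrewiseGraph_toLinearPMap_graph] at hy
    refine LinearPMap.mem_domain_of_mem_graph (y := a • y) ?_
    rw [fibrewiseGraph_toLinearPMap_graph]
    exact fun p => periodicGraph.smul_mem (a p) (hy p)
  · rw [adjoint_fibrewise]
    exact dense_fibrewise_domain
  · rw [adjoint_fibrewise]
    -- `1 + t*t**` is even onto: `R` and `Q` do not depend on the fibre, so applying them pointwise
    -- preserves continuity.
    obtain ⟨R, Q, H⟩ := exists_resolvent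
    refine dense_univ.mono fun y _ => ?_
    let f : tModule := ⟨fun p => R (y p), by fun_prop⟩
    have hf : (f, y - f) ∈ (comp fibrewiseGraph.toLinearPMap fibrewiseGraph.toLinearPMap).graph := by
      refine mem_comp_graph_iff.2 ⟨⟨fun p => Q (y p), by fun_prop⟩, ?_⟩
      rw [fibrewiseGraph_toLinearPMap_graph]
      exact ⟨fun p => (H (y p)).1, fun p => (H (y p)).2⟩
    obtain ⟨x, hx, hx'⟩ := (LinearPMap.mem_graph_iff _).1 hf
    exact ⟨x, by rw [hx, hx']; exact add_sub_cancel f y⟩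

theorem t_not_isRegular : ¬ IsRegular C(unitInterval, ℂ) t := by
  intro H
  obtain ⟨_, ⟨x, rfl⟩, hx⟩ := H.dense_range.exists_dist_lt (ContinuousMap.const _ oneL2)
    (ε := 1 / 2) (by norm_num)
  obtain ⟨y, hy, hyz⟩ := mem_comp_graph_iff.1 (LinearPMap.mem_graph _ x)
  generalize comp (adjoint C(unitInterval, ℂ) t) t x = z at hx hyz
  rw [adjoint_t, fibrewiseGraph_toLinearPMap_graph] at hyz
  obtain ⟨h0, h1⟩ := mem_t_graph_iff.1 hy
  -- Write `x₀, y₀, z₀` for the fibres at 0. Subtracting the constant 1 does not change the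
  -- derivative, so `x₀ - 1`, `y₀`, `z₀` is again a chain for `S`; both `‖x₀ - 1‖` and `‖y₀‖` are at
  -- most `‖x₀ - 1 + z₀‖ < 1/2`.
  have hsub := periodicGraph.sub_mem (h1 0) oneL2_mem_periodicGraph
  rw [Prod.mk_sub_mk, sub_zero] at hsub
  obtain ⟨ha, hb⟩ := norm_le_of_mem_periodicGraph hsub (hyz 0)
  -- Only here is the vanishing boundary condition used: `x₀ = V(-i y₀)` has no constant term. Then
  -- `1 ≤ ‖x₀‖ + ‖x₀ - 1‖ < 1`.
  have hv : ‖(x : tModule) 0‖ ≤ ‖y 0‖ := by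
    rw [(mem_vanishingGraph.1 h0).2]
    refine (norm_volterra_le _).trans_eq ?_
    simp [norm_smul]
  have hd : ‖(x : tModule) 0 - oneL2 + z 0‖ < 1 / 2 := by
    have := (ContinuousMap.dist_apply_le_dist (0 : unitInterval)).trans_lt hx
    rw [dist_comm, dist_eq_norm] at this
    convert! this using 2
    simp only [ContinuousMap.add_apply, ContinuousMap.const_apply]
    abel
  have hone : ‖oneL2‖ ≤ ‖(x : tModule) 0‖ + ‖(x : tModule) 0 - oneL2‖ := by
    simpa using norm_sub_le ((x : tModule) 0) ((x : tModule) 0 - oneL2)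
  rw [norm_oneL2] at hone
  linarith

theorem exists_mem_comp_domain_dist_lt {f h : tModule} (hf : (f, h) ∈ t.graph) {ε : ℝ} (hε : 0 < ε) :
    ∃ f' h', (f', h') ∈ t.graph ∧ f' ∈ (comp (adjoint C(unitInterval, ℂ) t) t).domain ∧
      dist (f', h') (f, h) < ε := by
  obtain ⟨g, k, hg, hd⟩ := exists_mem_t_graph_dist_lt h (half_pos hε)
  -- Projecting off 1 makes `h'` a possible derivative and keeps it in the domain of `t*`, which
  -- contains constants even in fibre 0. Then `f'` integrates the change `h' - h` from 0, which
  -- preserves the boundary conditions of `f`.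
  let h' : tModule := ⟨fun p => g p - ⟪oneL2, g p⟫_ℂ • oneL2, by fun_prop⟩
  let f' : tModule := ⟨fun p => f p + volterra (-Complex.I • (h' p - h p)), by fun_prop⟩
  have hh : ∀ p, ⟪oneL2, h p⟫_ℂ = 0 := fun p => (mem_periodicGraph.1 (t_graph_le hf p)).1
  have hdiff : ∀ p, (f' p - f p, h' p - h p) ∈ vanishingGraph := fun p => by
    refine mem_vanishingGraph.2 ⟨?_, add_sub_cancel_left _ _⟩
    rw [inner_sub_right, hh]
    simp [h', inner_sub_right, inner_smul_right, norm_oneL2]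
  have ht : (f', h') ∈ t.graph := by
    have : (f', h') = (f' - f, h' - h) + (f, h) := by simp
    rw [this]
    exact t.graph.add_mem
      (mem_t_graph_iff.2 ⟨hdiff 0, fun p => vanishingGraph_le (hdiff p)⟩) hf
  have hk : (h', k) ∈ fibrewiseGraph := fun p => by
    have := periodicGraph.sub_mem (t_graph_le hg p)
      (periodicGraph.smul_mem ⟪oneL2, g p⟫_ℂ oneL2_mem_periodicGraph)
    rwa [Prod.smul_mk, smul_zero, Prod.mk_sub_mk, sub_zero] at this
  have hnorm : ∀ p, ‖h' p - h p‖ < ε := fun p => by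
    have h1 : ‖g p - h p‖ < ε / 2 := by
      rw [← dist_eq_norm]
      exact (ContinuousMap.dist_apply_le_dist p).trans_lt hd
    have h2 : h' p - h p = (g p - h p) - ⟪oneL2, g p - h p⟫_ℂ • oneL2 := by
      rw [inner_sub_right, hh, sub_zero]
      simp only [h', ContinuousMap.coe_mk]
      abel
    -- As `h p ⟂ 1`, the correction costs at most another `‖g p - h p‖`, hence the choice of `ε / 2`
    -- for `g`.
    have h3 : ‖⟪oneL2, g p - h p⟫_ℂ • oneL2‖ ≤ ‖g p - h p‖ := by
      rw [norm_smul, norm_oneL2, mul_one]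
      simpa [norm_oneL2] using norm_inner_le_norm (𝕜 := ℂ) oneL2 (g p - h p)
    rw [h2]
    linarith [norm_sub_le (g p - h p) (⟪oneL2, g p - h p⟫_ℂ • oneL2)]
  refine ⟨f', h', ht, LinearPMap.mem_domain_of_mem_graph (y := k)
    (mem_comp_graph_iff.2 ⟨h', ht, ?_⟩), ?_⟩
  · rwa [adjoint_t, fibrewiseGraph_toLinearPMap_graph]
  · rw [Prod.dist_eq, max_lt_iff]
    refine ⟨(ContinuousMap.dist_lt_iff hε).2 fun p => ?_, (ContinuousMap.dist_lt_iff hε).2 fun p => ?_⟩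
    · rw [dist_eq_norm, (mem_vanishingGraph.1 (hdiff p)).2]
      refine (norm_volterra_le _).trans_lt ?_
      simpa [norm_smul] using hnorm p
    · rw [dist_eq_norm]
      exact hnorm p

theorem t_hasCore : t.HasCore (comp (adjoint C(unitInterval, ℂ) t) t).domain := by
  refine ⟨fun x hx => ?_, ?_⟩
  · obtain ⟨z, hz⟩ := LinearPMap.mem_domain_iff.1 hx
    obtain ⟨y, hy, -⟩ := mem_comp_graph_iff.1 hz
    exact LinearPMap.mem_domain_of_mem_graph hy
  · have hle : t.domRestrict (comp (adjoint C(unitInterval, ℂ) t) t).domain ≤ t :=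
      LinearPMap.domRestrict_le
    refine LinearPMap.eq_of_eq_graph ?_
    -- The claim becomes density of the restricted graph in the closed graph of `t`.
    rw [← (t_isClosed.isClosable.leIsClosable hle).graph_closure_eq_closure_graph]
    refine le_antisymm
      (Submodule.topologicalClosure_minimal _ (LinearPMap.le_graph_of_le hle) t_isClosed) ?_
    rintro ⟨f, h⟩ hf
    refine Metric.mem_closure_iff.2 fun ε hε => ?_
    obtain ⟨f', h', ht, hc, hd⟩ := exists_mem_comp_domain_dist_lt hf hε
    refine ⟨(f', h'), ?_, by rwa [dist_comm]⟩
    obtain ⟨x, rfl, rfl⟩ := (LinearPMap.mem_graph_iff _).1 ht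
    exact (LinearPMap.mem_graph_iff _).2 ⟨⟨x, hc, x.2⟩, rfl, LinearPMap.domRestrict_apply rfl⟩

end HilbertModule

end

theorem proposition2p3 :
    (HilbertModule.t.IsClosed ∧
      HilbertModule.IsSemiregular C(unitInterval, ℂ) HilbertModule.t ∧
      ¬ HilbertModule.IsRegular C(unitInterval, ℂ) HilbertModule.t) ∧
    HilbertModule.IsRegular C(unitInterval, ℂ)
      (HilbertModule.adjoint C(unitInterval, ℂ) HilbertModule.t) ∧
    HilbertModule.t.HasCore
      (HilbertModule.comp (HilbertModule.adjoint C(unitInterval, ℂ) HilbertModule.t)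
        HilbertModule.t).domain ∧
    ¬ ∀ (A E F : Type) [NonUnitalCStarAlgebra A] [PartialOrder A] [StarOrderedRing A]
        [TopologicalSpace.SeparableSpace A]
        [NormedAddCommGroup E] [NormedSpace ℂ E] [CompleteSpace E] [SMul A E] [CStarModule A E]
        [NormedAddCommGroup F] [NormedSpace ℂ F] [CompleteSpace F] [SMul A F] [CStarModule A F]
        (T : E →ₗ.[ℂ] F), T.IsClosed → HilbertModule.IsSemiregular A T →
        HilbertModule.IsRegular A (HilbertModule.adjoint A T) →
        HilbertModule.IsRegular A T := by

  open HilbertModule in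
  exact ⟨⟨t_isClosed, t_isSemiregular, t_not_isRegular⟩, adjoint_t_isRegular, t_hasCore, fun H =>
    t_not_isRegular (H C(unitInterval, ℂ) tModule tModule t t_isClosed t_isSemiregular
      adjoint_t_isRegular)⟩
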